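/- **Theorem.** Let $r\ge 0$ be an integer and let $G$ be a finite simple graph on $n$ vertices with maximum degree $\Delta(G)\le r$. Write $n=a(r+1)+b$ with integers $a\ge 0$ and $0\le b\le r$. For a graph $F$ let $n(F)$ be its number of vertices and $k_t(F)$ the number of complete subgraphs of $F$ on $t$ vertices; let $K_m$ be the complete graph on $m$ vertices, $\cup$ the disjoint union of graphs, and $cF$ the disjoint union of $c$ copies of $F$. 1. Assume that it is not the case that both $r=1$ and $n$ is odd. Then there are an integer $a'\ge 0$ and a graph $H$ (possibly with no vertices) with $\Delta(H)\le r$ and $$n(H)\le \frac{2r(r+1)}{3\sqrt 3}$$ such that $$n=a'(r+1)+n(H)\qquad\text{and}\qquad k_t(G)\le k_t(a'K_{r+1}\cup H)\quad\text{for every integer } t\ge 3.$$ 2. If $r\le 6$, then $$k_t(G)\le k_t(aK_{r+1}\cup K_b)\quad\text{for every integer } t\ge 3.$$ In particular $k_3(G)\le k_3(aK_{r+1}\cup K_b)$. In other words, the Gan–Loh–Sudakov conjecture, that the last displayed inequality holds for all $n$, all $r$, every graph $G$ on $n$ vertices with $\Delta(G)\le r$ and every $t\ge 3$, is true for $r\le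 6$. -/

import Mathlib

/-- `numCliques G t` is the number `k_t(G)` of complete subgraphs of `G` on `t` vertices,
that is, of `t`-element vertex sets that are cliques. -/
noncomputable def numCliques {V : Type*} [Fintype V] (G : SimpleGraph V) (t : ℕ) : ℕ :=
  open Classical in (G.cliqueFinset t).card

/-- `disjointCopies a G` is the graph `aG`, the disjoint union of `a` copies of `G`:
the vertex `(i, v)` is the copy of `v` in the `i`-th copy of `G`. -/
def disjointCopies {V : Type*} (a : ℕ) (G : SimpleGraph V) : SimpleGraph (Fin a × V) where
  Adj p q := p.1 = q.1 ∧ G.Adj p.2 q.2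
  symm := ⟨fun _ _ h => ⟨h.1.symm, h.2.symm⟩⟩
  loopless := ⟨fun _ h => G.irrefl h.2⟩

/-- The complete graph `K_m` on `m` vertices. -/
abbrev completeOn (m : ℕ) : SimpleGraph (Fin m) := SimpleGraph.completeGraph (Fin m)

/-!
The bound `k_t(G) ≤ k_t(aK_{r+1} ∪ K_b)` holds for every `r` and every `t ≥ 3`, and both parts follow
from it. For the first part take `H = K_b`: if `r ≥ 2` then `b ≤ r ≤ 2r(r+1)/(3√3)`, if `r = 0` then
`b = 0`, and if `r = 1` then `b` is the parity of `n`, hence `0` when `n` is even.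

The bound is proved by removing closed neighbourhoods. Call a `t`-clique *touching* for `v` if it
meets the closed neighbourhood of `v`. Double counting shows
`∑ v, #(touching cliques of v) ≤ ∑ v, (d(v) + 1).choose t` (`sum_card_touchingCliquesIn_le`):

* the touching cliques through `v` number at most `(d(v)).choose (t - 1)`, as removing `v` from
  such a clique leaves `t - 1` neighbours of `v`;
* pairs `(v, s)` with `s` a clique missing `v` and adjacent to it are compared with stars `K_{1,t}`
  centred at `v`, separately on each set of `t + 1` vertices (`card_coneApices_le`).

So some `v` has at most `(d(v) + 1).choose t` touching cliques. Deleting its closed neighbourhood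
and inducting, `k_t(G)` is at most the number of `t`-cliques in a disjoint union of complete graphs
with at most `r + 1` vertices each and `n` vertices in total. By convexity of binomial coefficients
(`choose_add_balancedCount_le`) such a union has the most cliques when it is `aK_{r+1} ∪ K_b`.
-/

open Finset

/-! ### Convexity of binomial coefficients -/

theorem choose_add_add_choose_le (t x y k : ℕ) (hxy : x ≤ y) :
    (x + k).choose t + y.choose t ≤ x.choose t + (y + k).choose t := by
  induction k with
  | zero => simp
  | succ k ih =>
    rcases t with _ | t
    · simp
    · have h := Nat.choose_le_choose t (show x + k ≤ y + k by omega)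
      have h1 := Nat.choose_succ_succ (x + k) t
      have h2 := Nat.choose_succ_succ (y + k) t
      simp only [Nat.succ_eq_add_one] at h1 h2
      rw [← add_assoc x, ← add_assoc y]
      omega

/-- The number of `t`-cliques, for `t ≥ 1`, of the graph on `n` vertices that is a disjoint union of
copies of `K_{r+1}` and one smaller complete graph on the remaining vertices. -/
def balancedCount (r t n : ℕ) : ℕ :=
  n / (r + 1) * (r + 1).choose t + (n % (r + 1)).choose t

theorem balancedCount_mul_add {r t q s : ℕ} (hs : s ≤ r) :
    balancedCount r t (q * (r + 1) + s) = q * (r + 1).choose t + s.choose t := by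
  have h1 : (q * (r + 1) + s) / (r + 1) = q := by
    rw [add_comm, Nat.add_mul_div_right _ _ (Nat.succ_pos r), Nat.div_eq_of_lt (by omega), zero_add]
  have h2 : (q * (r + 1) + s) % (r + 1) = s := by
    rw [add_comm, Nat.add_mul_mod_self_right, Nat.mod_eq_of_lt (by omega)]
  rw [balancedCount, h1, h2]

theorem choose_add_balancedCount_le {r t m n : ℕ} (ht : 1 ≤ t) (hm : m ≤ r + 1) :
    m.choose t + balancedCount r t n ≤ balancedCount r t (n + m) := by
  obtain ⟨q, s, hs, rfl⟩ : ∃ q s, s ≤ r ∧ n = q * (r + 1) + s :=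
    ⟨n / (r + 1), n % (r + 1), Nat.lt_succ_iff.1 (Nat.mod_lt _ (Nat.succ_pos r)),
      (Nat.div_add_mod' n (r + 1)).symm⟩
  rw [balancedCount_mul_add hs]
  -- Either the smaller clique and `K_m` overflow into a further `K_{r+1}` leaving `K_x`, or they merge.
  rcases Nat.lt_or_ge r (s + m) with h | h
  · obtain ⟨x, hx⟩ := Nat.exists_eq_add_of_lt h
    have e : q * (r + 1) + s + m = (q + 1) * (r + 1) + x := by
      rw [add_assoc, hx]; ring
    rw [e, balancedCount_mul_add (by omega)]
    have h2 := choose_add_add_choose_le t x s (r + 1 - s) (by omega)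
    rw [show x + (r + 1 - s) = m by omega, show s + (r + 1 - s) = r + 1 by omega] at h2
    rw [add_mul, one_mul]
    omega
  · rw [add_assoc, balancedCount_mul_add h]
    have h2 := choose_add_add_choose_le t 0 s m (Nat.zero_le _)
    rw [zero_add, Nat.choose_eq_zero_of_lt (show 0 < t by omega)] at h2
    omega

/-! ### Cliques touching a closed neighbourhood -/

section Touching

open Classical in
/-- The `t`-cliques of `G` all of whose vertices lie in `A`. -/
noncomputable def cliquesIn {V : Type*} (G : SimpleGraph V) (A : Finset V) (t : ℕ) :
    Finset (Finset V) :=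
  {s ∈ A.powersetCard t | G.IsClique s}

open Classical in
/-- The neighbours of `v` in `A`. -/
noncomputable def neighborsIn {V : Type*} (G : SimpleGraph V) (A : Finset V) (v : V) : Finset V :=
  {u ∈ A | G.Adj v u}

open Classical in
/-- The `t`-cliques in `A` that meet the closed neighbourhood of `v`. -/
noncomputable def touchingCliquesIn {V : Type*} (G : SimpleGraph V) (A : Finset V) (t : ℕ) (v : V) :
    Finset (Finset V) :=
  {s ∈ cliquesIn G A t | ∃ u ∈ s, u = v ∨ G.Adj v u}

open Classical in
/-- Both sides count the pairs `(v, s)` with `v ∉ s` and `P v s`; on the right they are grouped by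
`S = insert v s`. -/
theorem sum_card_filter_notMem_eq_sum_card_filter_erase {V : Type*} (A : Finset V) (t : ℕ)
    (P : V → Finset V → Prop) :
    ∑ v ∈ A, #{s ∈ A.powersetCard t | v ∉ s ∧ P v s} =
      ∑ S ∈ A.powersetCard (t + 1), #{v ∈ S | P v (S.erase v)} := by
  rw [← card_sigma, ← card_sigma]
  refine card_bij' (fun p _ => ⟨insert p.1 p.2, p.1⟩) (fun p _ => ⟨p.2, p.1.erase p.2⟩) ?_ ?_ ?_ ?_
  · rintro ⟨v, s⟩ h
    simp only [mem_sigma, mem_filter, mem_powersetCard] at h ⊢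
    obtain ⟨hv, ⟨hs, hc⟩, hvs, hP⟩ := h
    refine ⟨⟨insert_subset hv hs, by rw [card_insert_of_notMem hvs, hc]⟩, mem_insert_self _ _, ?_⟩
    rwa [erase_insert hvs]
  · rintro ⟨S, v⟩ h
    simp only [mem_sigma, mem_filter, mem_powersetCard] at h ⊢
    obtain ⟨⟨hs, hc⟩, hvs, hP⟩ := h
    exact ⟨hs hvs, ⟨(erase_subset _ _).trans hs, by rw [card_erase_of_mem hvs, hc]; rfl⟩,
      notMem_erase _ _, hP⟩
  · rintro ⟨v, s⟩ h
    simp only [mem_sigma, mem_filter] at h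
    simp [erase_insert h.2.2.1]
  · rintro ⟨S, v⟩ h
    simp only [mem_sigma, mem_filter] at h
    simp [insert_erase h.2.1]

open Classical in
/-- On a set `S` of at least four vertices, at most as many vertices are adjacent to a clique formed
by all the others as there are vertices adjacent to all the others. Every neighbour of a vertex of
the first kind is a vertex of the second kind, which settles the case of a single one. Two distinct vertices of the
first kind are either adjacent, and then `S` is a clique, or they are the only ones, and then the
remaining vertices, of which there are at least two, are of the second kind. -/
theorem card_coneApices_le {V : Type*} (G : SimpleGraph V) (S : Finset V) (hS : 4 ≤ #S) :
    #{v ∈ S | G.IsClique (S.erase v : Finset V) ∧ ∃ u ∈ S.erase v, G.Adj v u} ≤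
      #{v ∈ S | ∀ u ∈ S.erase v, G.Adj v u} := by
  rcases Nat.lt_or_ge 1 #{v ∈ S | G.IsClique (S.erase v : Finset V) ∧ ∃ u ∈ S.erase v, G.Adj v u}
    with h | h
  · obtain ⟨v, hv, w, hw, hvw⟩ := one_lt_card.1 h
    simp only [mem_filter] at hv hw
    obtain ⟨hvS, hvc, -⟩ := hv
    obtain ⟨hwS, hwc, -⟩ := hw
    have adj {x y : V} (hx : x ∈ S) (hy : y ∈ S) (hxy : x ≠ y)
        (hxv : ¬ (x = v ∧ y = w)) (hxw : ¬ (x = w ∧ y = v)) : G.Adj x y := by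
      by_cases h : x ≠ v ∧ y ≠ v
      · exact hvc (by simp [hx, h.1]) (by simp [hy, h.2]) hxy
      · refine hwc ?_ ?_ hxy <;> simp only [coe_erase, Set.mem_sdiff, mem_coe, Set.mem_singleton_iff]
          <;> refine ⟨by assumption, ?_⟩ <;> rintro rfl <;> grind
    by_cases hA : G.Adj v w
    · refine card_le_card fun x hx => ?_
      simp only [mem_filter] at hx ⊢
      refine ⟨hx.1, fun u hu => ?_⟩
      by_cases h1 : x = v ∧ u = w
      · rwa [h1.1, h1.2]
      by_cases h2 : x = w ∧ u = v
      · rw [h2.1, h2.2]; exact hA.symm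
      exact adj hx.1 (mem_of_mem_erase hu) (ne_of_mem_erase hu).symm h1 h2
    · have hL : {v ∈ S | G.IsClique (S.erase v : Finset V) ∧ ∃ u ∈ S.erase v, G.Adj v u} ⊆
          {v, w} := by
        intro x hx
        simp only [mem_filter] at hx
        by_contra hne
        simp only [mem_insert, mem_singleton, not_or] at hne
        exact hA (hx.2.1 (by simpa using ⟨hvS, Ne.symm hne.1⟩)
          (by simpa using ⟨hwS, Ne.symm hne.2⟩) hvw)
      have hR : (S.erase v).erase w ⊆ {v ∈ S | ∀ u ∈ S.erase v, G.Adj v u} := by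
        intro x hx
        simp only [mem_erase] at hx
        refine mem_filter.2 ⟨hx.2.2, fun u hu => adj hx.2.2 (mem_of_mem_erase hu)
          (ne_of_mem_erase hu).symm (fun h => hx.2.1 h.1) (fun h => hx.1 h.1)⟩
      have h1 := (card_le_card hL).trans card_le_two
      have h2 := card_le_card hR
      rw [card_erase_of_mem (mem_erase.2 ⟨hvw.symm, hwS⟩), card_erase_of_mem hvS] at h2
      omega
  · rcases Nat.eq_zero_or_pos
      #{v ∈ S | G.IsClique (S.erase v : Finset V) ∧ ∃ u ∈ S.erase v, G.Adj v u} with h0 | h0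
    · omega
    · refine h.trans (card_pos.2 ?_)
      obtain ⟨v, hv⟩ := card_pos.1 h0
      simp only [mem_filter] at hv
      obtain ⟨hvS, hvc, u, hu, hvu⟩ := hv
      refine ⟨u, mem_filter.2 ⟨mem_of_mem_erase hu, fun w hw => ?_⟩⟩
      by_cases hwv : w = v
      · rw [hwv]; exact hvu.symm
      · exact hvc (mem_coe.2 hu) (mem_coe.2 (mem_erase.2 ⟨hwv, mem_of_mem_erase hw⟩))
          (ne_of_mem_erase hw).symm

open Classical in
theorem card_filter_mem_cliquesIn_le {V : Type*} (G : SimpleGraph V) (A : Finset V) (t : ℕ)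
    (v : V) : #{s ∈ cliquesIn G A (t + 1) | v ∈ s} ≤ (#(neighborsIn G A v)).choose t := by
  rw [← card_powersetCard]
  refine card_le_card_of_injOn (fun s => s.erase v) ?_ ?_
  · intro s hs
    simp only [cliquesIn, coe_filter, mem_filter, mem_powersetCard, Set.mem_ofPred_eq] at hs
    obtain ⟨⟨⟨hsA, hc⟩, hcl⟩, hv⟩ := hs
    refine mem_coe.2 (mem_powersetCard.2 ⟨fun u hu => ?_, by rw [card_erase_of_mem hv, hc]; rfl⟩)
    exact mem_filter.2 ⟨hsA (mem_of_mem_erase hu),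
      hcl (mem_coe.2 hv) (mem_coe.2 (mem_of_mem_erase hu)) (ne_of_mem_erase hu).symm⟩
  · intro s hs s' hs' h
    simp only [coe_filter, Set.mem_ofPred_eq] at hs hs'
    rw [← insert_erase hs.2, ← insert_erase hs'.2]
    exact congrArg (insert v) h

open Classical in
theorem sum_card_filter_notMem_cliquesIn_le {V : Type*} (G : SimpleGraph V) (A : Finset V) {t : ℕ}
    (ht : 3 ≤ t) :
    ∑ v ∈ A, #((A.powersetCard t).filter fun s : Finset V => v ∉ s ∧ (G.IsClique s ∧ ∃ u ∈ s, G.Adj v u)) ≤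
      ∑ v ∈ A, (#(neighborsIn G A v)).choose t := by
  have star (v : V) : {s ∈ A.powersetCard t | v ∉ s ∧ ∀ u ∈ s, G.Adj v u} =
      (neighborsIn G A v).powersetCard t := by
    ext s
    simp only [mem_filter, mem_powersetCard, neighborsIn, subset_iff]
    refine ⟨fun h => ⟨fun u hu => ⟨h.1.1 hu, h.2.2 u hu⟩, h.1.2⟩,
      fun h => ⟨⟨fun u hu => (h.1 hu).1, h.2⟩, fun hv => G.irrefl (h.1 hv).2,
        fun u hu => (h.1 hu).2⟩⟩
  calc _ = ∑ S ∈ A.powersetCard (t + 1),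
        #{v ∈ S | G.IsClique (S.erase v : Finset V) ∧ ∃ u ∈ S.erase v, G.Adj v u} :=
        by
          convert sum_card_filter_notMem_eq_sum_card_filter_erase A t
            fun v (s : Finset V) => G.IsClique s ∧ ∃ u ∈ s, G.Adj v u
    _ ≤ ∑ S ∈ A.powersetCard (t + 1), #{v ∈ S | ∀ u ∈ S.erase v, G.Adj v u} :=
        sum_le_sum fun S hS => card_coneApices_le G S (by rw [(mem_powersetCard.1 hS).2]; omega)
    _ = ∑ v ∈ A, #{s ∈ A.powersetCard t | v ∉ s ∧ ∀ u ∈ s, G.Adj v u} :=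
        by
          convert (sum_card_filter_notMem_eq_sum_card_filter_erase A t
            fun v s => ∀ u ∈ s, G.Adj v u).symm
    _ = _ := sum_congr rfl fun v _ => by rw [star, card_powersetCard]

open Classical in
theorem sum_card_touchingCliquesIn_le {V : Type*} (G : SimpleGraph V) (A : Finset V) {t : ℕ}
    (ht : 3 ≤ t) :
    ∑ v ∈ A, #(touchingCliquesIn G A t v) ≤ ∑ v ∈ A, (#(neighborsIn G A v) + 1).choose t := by
  obtain ⟨k, rfl⟩ : ∃ k, t = k + 1 := ⟨t - 1, by omega⟩
  have split (v : V) : #(touchingCliquesIn G A (k + 1) v) ≤ #{s ∈ cliquesIn G A (k + 1) | v ∈ s} +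
      #((A.powersetCard (k + 1)).filter fun s : Finset V => v ∉ s ∧ (G.IsClique s ∧ ∃ u ∈ s, G.Adj v u)) := by
    refine (card_le_card fun s hs => ?_).trans (card_union_le _ _)
    simp only [touchingCliquesIn, cliquesIn, mem_filter, mem_union] at hs ⊢
    obtain ⟨⟨hsA, hcl⟩, u, hu, h⟩ := hs
    by_cases hv : v ∈ s
    · exact Or.inl ⟨⟨hsA, hcl⟩, hv⟩
    · exact Or.inr ⟨hsA, hv, hcl, u, hu, h.resolve_left fun e => hv (e ▸ hu)⟩
  calc _ ≤ ∑ v ∈ A, (#{s ∈ cliquesIn G A (k + 1) | v ∈ s} +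
        #((A.powersetCard (k + 1)).filter fun s : Finset V => v ∉ s ∧ (G.IsClique s ∧ ∃ u ∈ s, G.Adj v u))) :=
        sum_le_sum fun v _ => split v
    _ ≤ ∑ v ∈ A, (#(neighborsIn G A v)).choose k +
        ∑ v ∈ A, (#(neighborsIn G A v)).choose (k + 1) := by
        rw [sum_add_distrib]
        exact add_le_add (sum_le_sum fun v _ => card_filter_mem_cliquesIn_le G A k v)
          (sum_card_filter_notMem_cliquesIn_le G A ht)
    _ = _ := by
        rw [← sum_add_distrib]
        exact sum_congr rfl fun v _ => (Nat.choose_succ_succ _ _).symm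

end Touching

/-! ### The clique bound for bounded maximum degree -/

open Classical in
theorem card_cliquesIn_le_balancedCount {V : Type*} (G : SimpleGraph V) {r t : ℕ} (ht : 3 ≤ t)
    (A : Finset V) (hA : ∀ v ∈ A, #(neighborsIn G A v) ≤ r) :
    #(cliquesIn G A t) ≤ balancedCount r t #A := by
  induction A using Finset.strongInduction with
  | H A ih =>
    rcases A.eq_empty_or_nonempty with rfl | hne
    · have : cliquesIn G ∅ t = ∅ := by
        rw [cliquesIn, powersetCard_eq_empty.2 (by simp; omega), filter_empty]
      simp [this]
    obtain ⟨v, hv, hle⟩ := exists_le_of_sum_le hne (sum_card_touchingCliquesIn_le G A ht)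
    -- The closed neighbourhood of `v` in `A` is deleted.
    set N := insert v (neighborsIn G A v) with hN
    have hNA : N ⊆ A := insert_subset hv (filter_subset _ _)
    have hNc : #N = #(neighborsIn G A v) + 1 :=
      card_insert_of_notMem fun h => G.irrefl (mem_filter.1 h).2
    have hss : A \ N ⊂ A := sdiff_ssubset hNA ⟨v, mem_insert_self _ _⟩
    have hrec := ih (A \ N) hss fun w hw =>
      (card_le_card (filter_subset_filter _ sdiff_subset)).trans (hA w (mem_sdiff.1 hw).1)
    have hsplit : #(cliquesIn G A t) ≤ #(touchingCliquesIn G A t v) + #(cliquesIn G (A \ N) t) := by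
      refine (card_le_card fun s hs => ?_).trans (card_union_le _ _)
      by_cases h : ∃ u ∈ s, u = v ∨ G.Adj v u
      · exact mem_union_left _ (mem_filter.2 ⟨hs, h⟩)
      · refine mem_union_right _ ?_
        simp only [cliquesIn, mem_filter, mem_powersetCard] at hs ⊢
        refine ⟨⟨fun u hu => mem_sdiff.2 ⟨hs.1.1 hu, fun huN => h ⟨u, hu, ?_⟩⟩, hs.1.2⟩, hs.2⟩
        exact (mem_insert.1 huN).imp_right fun h => (mem_filter.1 h).2
    have hconv := choose_add_balancedCount_le (n := #(A \ N)) (show 1 ≤ t by omega)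
      (show #N ≤ r + 1 by have := hA v hv; omega)
    rw [card_sdiff_add_card_eq_card hNA, hNc] at hconv
    omega

theorem numCliques_le_balancedCount {V : Type*} [Fintype V] (G : SimpleGraph V)
    [DecidableRel G.Adj] {r t : ℕ} (hΔ : G.maxDegree ≤ r) (ht : 3 ≤ t) :
    numCliques G t ≤ balancedCount r t (Fintype.card V) := by
  classical
  have h := card_cliquesIn_le_balancedCount G ht univ (r := r) fun v _ => by
    refine le_trans (le_of_eq ?_) ((G.degree_le_maxDegree v).trans hΔ)
    rw [← G.card_neighborFinset_eq_degree]
    congr 1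
    ext u
    simp [neighborsIn]
  rw [card_univ] at h
  refine le_trans (le_of_eq ?_) h
  rw [numCliques]
  congr 1
  ext s
  simp [cliquesIn, SimpleGraph.isNClique_iff, and_comm]

/-! ### Cliques in disjoint unions of complete graphs -/

theorem numCliques_eq_card_filter {V : Type*} [Fintype V] (G : SimpleGraph V) (t : ℕ)
    [DecidablePred (G.IsNClique t)] : numCliques G t = #{s : Finset V | G.IsNClique t s} := by
  refine congrArg card ?_
  ext s
  simp [SimpleGraph.mem_cliqueFinset_iff]

theorem isNClique_map_of_adj {V W : Type*} {G : SimpleGraph V} {H : SimpleGraph W} (f : V ↪ W)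
    (hf : ∀ u v, G.Adj u v → H.Adj (f u) (f v)) {t : ℕ} {s : Finset V} (hs : G.IsNClique t s) :
    H.IsNClique t (s.map f) :=
  hs.map.mono (SimpleGraph.map_le_iff_le_comap _ _ _ |>.2 hf)

theorem numCliques_add_numCliques_le_sum {V W : Type*} [Fintype V] [Fintype W] (G : SimpleGraph V)
    (H : SimpleGraph W) {t : ℕ} (ht : 1 ≤ t) :
    numCliques G t + numCliques H t ≤ numCliques (G ⊕g H) t := by
  classical
  simp only [numCliques_eq_card_filter]
  rw [← card_disjSum]
  refine card_le_card_of_injOn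
    (Sum.elim (fun s => s.map Function.Embedding.inl) (fun s => s.map Function.Embedding.inr)) ?_ ?_
  · rintro (s | s) hs <;>
      exact mem_coe.2 (mem_filter.2 ⟨mem_univ _, isNClique_map_of_adj _
        (fun u v h => by simpa using h) (by simpa using hs)⟩)
  · have ne {s : Finset V} {s' : Finset W} (hs : G.IsNClique t s) :
        s.map Function.Embedding.inl ≠ s'.map Function.Embedding.inr := by
      intro h
      have hc := hs.card_eq
      obtain ⟨x, hx⟩ := card_pos.1 (show 0 < #s by omega)
      have := h ▸ mem_map_of_mem Function.Embedding.inl hx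
      simp at this
    rintro (s | s) hs (s' | s') hs' h
    · exact congrArg Sum.inl (map_injective _ h)
    · exact (ne (by simpa using hs) h).elim
    · exact (ne (by simpa using hs') h.symm).elim
    · exact congrArg Sum.inr (map_injective _ h)

theorem mul_numCliques_le_disjointCopies {V : Type*} [Fintype V] (a : ℕ) (G : SimpleGraph V) {t : ℕ}
    (ht : 1 ≤ t) : a * numCliques G t ≤ numCliques (disjointCopies a G) t := by
  classical
  simp only [numCliques_eq_card_filter]
  suffices h : #((univ : Finset (Fin a)) ×ˢ ({s | G.IsNClique t s} : Finset (Finset V))) ≤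
      #{s : Finset (Fin a × V) | (disjointCopies a G).IsNClique t s} by
    rwa [card_product, card_univ, Fintype.card_fin] at h
  let f (i : Fin a) : V ↪ Fin a × V := ⟨fun v => (i, v), Prod.mk_right_injective i⟩
  refine card_le_card_of_injOn (fun p => p.2.map (f p.1)) ?_ ?_
  · rintro ⟨i, s⟩ hs
    have hs : G.IsNClique t s := by simpa using hs
    have hadj (u v : V) (h : G.Adj u v) : (disjointCopies a G).Adj (f i u) (f i v) := ⟨rfl, h⟩
    exact mem_coe.2 (mem_filter.2 ⟨mem_univ _, isNClique_map_of_adj (f i) hadj hs⟩)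
  · rintro ⟨i, s⟩ hs ⟨j, s'⟩ - h
    have hs : G.IsNClique t s := by simpa using hs
    have hc := hs.card_eq
    obtain ⟨x, hx⟩ := card_pos.1 (show 0 < #s by omega)
    change s.map (f i) = s'.map (f j) at h
    obtain ⟨y, -, hy⟩ := mem_map.1 (h ▸ mem_map_of_mem (f i) hx)
    obtain rfl : j = i := congrArg Prod.fst hy
    rw [map_injective _ h]

theorem numCliques_completeOn (m t : ℕ) : numCliques (completeOn m) t = m.choose t := by
  classical
  rw [numCliques]
  trans #((univ : Finset (Fin m)).powersetCard t)
  · congr 1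
    ext s
    simp only [SimpleGraph.mem_cliqueFinset_iff, SimpleGraph.isNClique_iff, mem_powersetCard,
      subset_univ, true_and, and_iff_right_iff_imp]
    exact fun _ u _ v _ h => h
  · simp

theorem numCliques_le_completeOn_union {V : Type*} [Fintype V] (G : SimpleGraph V)
    [DecidableRel G.Adj] {r a b t : ℕ} (hΔ : G.maxDegree ≤ r)
    (hn : Fintype.card V = a * (r + 1) + b) (hb : b ≤ r) (ht : 3 ≤ t) :
    numCliques G t ≤ numCliques (disjointCopies a (completeOn (r + 1)) ⊕g completeOn b) t := by
  have h1 := numCliques_le_balancedCount G hΔ ht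
  have h2 := numCliques_add_numCliques_le_sum (disjointCopies a (completeOn (r + 1)))
    (completeOn b) (show 1 ≤ t by omega)
  have h3 := mul_numCliques_le_disjointCopies a (completeOn (r + 1)) (show 1 ≤ t by omega)
  rw [hn, balancedCount_mul_add hb] at h1
  rw [numCliques_completeOn] at h2 h3
  omega

/-! ### The numerical bound on the remaining component -/

theorem cast_le_two_mul_mul_div {r : ℕ} (hr : 2 ≤ r) :
    (r : ℝ) ≤ 2 * (r : ℝ) * ((r : ℝ) + 1) / (3 * Real.sqrt 3) := by
  have hr' : (2 : ℝ) ≤ r := by exact_mod_cast hr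
  have h3 : Real.sqrt 3 ≤ 2 := Real.sqrt_le_iff.2 ⟨by norm_num, by norm_num⟩
  have hpos : 0 < Real.sqrt 3 := Real.sqrt_pos.2 (by norm_num)
  rw [le_div_iff₀ (by positivity)]
  nlinarith

theorem mainTheorem1 {V : Type*} [Fintype V] (G : SimpleGraph V) [DecidableRel G.Adj]
    (r a b : ℕ) (hΔ : G.maxDegree ≤ r)
    (hn : Fintype.card V = a * (r + 1) + b) (hb : b ≤ r) :
    (¬ (r = 1 ∧ Odd (Fintype.card V)) →
      ∃ (a' m : ℕ) (H : SimpleGraph (Fin m)) (_ : DecidableRel H.Adj),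
        H.maxDegree ≤ r ∧
        (m : ℝ) ≤ 2 * (r : ℝ) * ((r : ℝ) + 1) / (3 * Real.sqrt 3) ∧
        Fintype.card V = a' * (r + 1) + m ∧
        ∀ t : ℕ, 3 ≤ t →
          numCliques G t ≤
            numCliques (disjointCopies a' (completeOn (r + 1)) ⊕g H) t) ∧
    (r ≤ 6 → ∀ t : ℕ, 3 ≤ t →
      numCliques G t ≤
        numCliques (disjointCopies a (completeOn (r + 1)) ⊕g (completeOn b)) t) := by
  classical
  refine ⟨fun hodd => ⟨a, b, completeOn b, inferInstance, ?_, ?_, hn, fun t ht =>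
    numCliques_le_completeOn_union G hΔ hn hb ht⟩, fun _ t ht =>
    numCliques_le_completeOn_union G hΔ hn hb ht⟩
  · refine SimpleGraph.maxDegree_le_of_forall_degree_le _ _ fun v => ?_
    have h := (completeOn b).degree_lt_card_verts v
    rw [Fintype.card_fin] at h
    omega
  · rcases Nat.lt_or_ge r 2 with hr | hr
    · have hb0 : b = 0 := by
        interval_cases r
        · omega
        · by_contra h0
          obtain rfl : b = 1 := by omega
          exact hodd ⟨rfl, a, by omega⟩
      rw [hb0, Nat.cast_zero]
      positivity
    · exact (Nat.cast_le.2 hb).trans (cast_le_two_mul_mul_div hr)
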